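/- **Corollary.** An *approach space* is a set $X$ with a function $\delta:X\times \mathsf PX\to[0,\infty]$ such that, for all $x\in X$, $A,B\subseteq X$, $\varepsilon\in[0,\infty]$: $\delta(x,\{x\})=0$; $\delta(x,\emptyset)=\infty$; $\delta(x,A\cup B)=\min\{\delta(x,A),\delta(x,B)\}$; and $\delta(x,A)\le\delta(x,A^{(\varepsilon)})+\varepsilon$, where $A^{(\varepsilon)}=\{y\in X\mid\delta(y,A)\le\varepsilon\}$. A map $f:(X,\delta)\to(Y,\delta')$ is *contractive* if $\delta'(fx,f(A))\le\delta(x,A)$ for all $x\in X$, $A\subseteq X$; this gives the category $\mathbf{App}$. Let $\mathbf\Delta$ be the set of maps $\varphi:[0,\infty]\to[0,1]$ with $\varphi(\beta)=\sup_{\alpha<\beta}\varphi(\alpha)$ for all $\beta\in[0,\infty]$, ordered pointwise, with $(\varphi\odot\psi)(\gamma)=\sup_{\alpha+\beta\le\gamma}\varphi(\alpha)\psi(\beta)$, and let $\kappa(0)=0$, $\kappa(\alpha)=1$ for $\alpha>0$. A *probabilistic approach space* is a set $X$ with a function $\delta:X\times\mathsf PX\to\mathbf\Delta$ such that, for all $x\in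 X$, $A,B\subseteq X$, $\varphi\in\mathbf\Delta$: $\delta(x,\{x\})=\kappa$; $\delta(x,\emptyset)=0$; $\delta(x,A\cup B)=\delta(x,A)\vee\delta(x,B)$; and $\delta(x,A)\ge\delta(x,A^{(\varphi)})\odot\varphi$, where $A^{(\varphi)}=\{y\in X\mid\delta(y,A)\ge\varphi\}$. A map $f:(X,\delta)\to(Y,\delta')$ is *contractive* if $\delta(x,A)\le\delta'(fx,f(A))$ for all $x\in X$, $A\subseteq X$; this gives the category $\mathbf{ProbApp}$. Define $\sigma:[0,\infty]\to\mathbf\Delta$ by $\sigma(\alpha)(\gamma)=0$ if $\gamma\le\alpha$ and $1$ otherwise, and $\lambda,\rho:\mathbf\Delta\to[0,\infty]$ by $\lambda(\varphi)=\sup\{\alpha\mid\varphi(\alpha)=0\}$ and $\rho(\varphi)=\inf\{\alpha\mid\varphi(\alpha)=1\}$. Then: 1. With $[0,\infty]$ ordered by $\ge$, there are adjunctions of monotone maps $\lambda\dashv\sigma\dashv\rho$. 2. The functor $B_\sigma:\mathbf{App}\to\mathbf{ProbApp}$, $(X,\delta)\mapsto(X,\sigma\circ\delta)$, $f\mapsto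 f$, is injective on objects, full and faithful. 3. $B_\sigma$ has a left adjoint, so that $\mathbf{App}$ is reflective in $\mathbf{ProbApp}$. A reflector is given by $(X,\delta)\mapsto(X,d)$, $f\mapsto f$, where $d$ is the numerically largest approach structure on $X$ with $d(x,A)\le\lambda(\delta(x,A))$ for all $x\in X$, $A\subseteq X$. 4. $B_\sigma$ has a right adjoint, so that $\mathbf{App}$ is coreflective in $\mathbf{ProbApp}$. A coreflector is given by $B_\rho:(X,\delta)\mapsto(X,\rho\circ\delta)$, $f\mapsto f$. -/

import Mathlib

open CategoryTheory
open scoped ENNReal unitInterval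

universe u

/-! ### Distance distribution functions -/

/-- A distance distribution function: a map `φ : [0,∞] → [0,1]` with
`φ(β) = sup_{α < β} φ(α)` for all `β` (the supremum is taken in `[0,1]`, so `φ(0) = 0`). -/
@[ext]
structure DistDistr where
  toFun : ℝ≥0∞ → I
  isLUB' : ∀ β : ℝ≥0∞, IsLUB (toFun '' Set.Iio β) (toFun β)

namespace DistDistr

instance : CoeFun DistDistr (fun _ => ℝ≥0∞ → I) := ⟨toFun⟩

theorem mono (φ : DistDistr) {α β : ℝ≥0∞} (h : α ≤ β) : φ α ≤ φ β := by
  rcases h.eq_or_lt with rfl | h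
  · exact le_rfl
  · exact (φ.isLUB' β).1 ⟨α, h, rfl⟩

theorem le_of_forall_lt (φ : DistDistr) {β : ℝ≥0∞} {b : I} (h : ∀ α < β, φ α ≤ b) :
    φ β ≤ b :=
  (φ.isLUB' β).2 (by rintro _ ⟨α, hα, rfl⟩; exact h α hα)

/-- The pointwise order. -/
instance : PartialOrder DistDistr where
  le φ ψ := ∀ γ, φ γ ≤ ψ γ
  le_refl _ _ := le_rfl
  le_trans _ _ _ h₁ h₂ γ := (h₁ γ).trans (h₂ γ)
  le_antisymm _ _ h₁ h₂ := DistDistr.ext (funext fun γ => le_antisymm (h₁ γ) (h₂ γ))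

/-- Binary joins in the pointwise order; they are computed pointwise. -/
instance : SemilatticeSup DistDistr where
  sup φ ψ :=
    { toFun := fun γ => φ γ ⊔ ψ γ
      isLUB' := fun β => by
        constructor
        · rintro _ ⟨α, hα, rfl⟩
          exact sup_le_sup (φ.mono (le_of_lt hα)) (ψ.mono (le_of_lt hα))
        · intro b hb
          exact sup_le (φ.le_of_forall_lt fun α hα => le_sup_left.trans (hb ⟨α, hα, rfl⟩))
            (ψ.le_of_forall_lt fun α hα => le_sup_right.trans (hb ⟨α, hα, rfl⟩)) }
  le_sup_left _ _ _ := le_sup_left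
  le_sup_right _ _ _ := le_sup_right
  sup_le _ _ _ h₁ h₂ γ := sup_le (h₁ γ) (h₂ γ)

/-- The bottom element: the constant function with value `0`. -/
instance : OrderBot DistDistr where
  bot :=
    { toFun := fun _ => 0
      isLUB' := fun β => ⟨by rintro _ ⟨_, _, rfl⟩; exact le_rfl, fun b _ => b.2.1⟩ }
  bot_le φ γ := (φ γ).2.1

theorem mul_le_of_isLUB {S : Set I} {s x b : I} (hs : IsLUB S s)
    (h : ∀ y ∈ S, x * y ≤ b) : x * s ≤ b := by
  by_contra hlt
  have hlt : (b : ℝ) < x * s := by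
    have := not_le.1 hlt
    exact_mod_cast this
  have hx : (0 : ℝ) < x := by
    rcases x.2.1.eq_or_lt with h0 | h0
    · rw [← h0, zero_mul] at hlt
      exact absurd hlt (not_lt.2 b.2.1)
    · exact h0
  have hbs : (b : ℝ) / x < s := by rw [div_lt_iff₀ hx]; linarith [mul_comm (x : ℝ) s]
  have hle : s ≤ (⟨(b : ℝ) / x, div_nonneg b.2.1 x.2.1, hbs.le.trans s.2.2⟩ : I) := by
    refine hs.2 fun y hy => ?_
    have h1 : (x : ℝ) * y ≤ b := by exact_mod_cast h y hy
    show (y : ℝ) ≤ b / x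
    rw [le_div_iff₀ hx]; linarith [mul_comm (x : ℝ) y]
  exact absurd (show (s : ℝ) ≤ b / x from hle) (not_le.2 hbs)

/-- The convolution product `(φ ⊙ ψ)(γ) = sup_{α + β ≤ γ} φ(α) ψ(β)`. -/
noncomputable def conv (φ ψ : DistDistr) : DistDistr where
  toFun γ := ⨆ (α : ℝ≥0∞) (β : ℝ≥0∞) (_ : α + β ≤ γ), φ α * ψ β
  isLUB' γ := by
    constructor
    · rintro _ ⟨γ', hγ', rfl⟩
      refine iSup_le fun α => iSup_le fun β => iSup_le fun h => ?_
      exact le_iSup_of_le α (le_iSup_of_le β (le_iSup_of_le (h.trans (le_of_lt hγ')) le_rfl))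
    · intro b hb
      refine iSup_le fun α => iSup_le fun β => iSup_le fun h => ?_
      refine mul_le_of_isLUB (ψ.isLUB' β) ?_
      rintro _ ⟨β', hβ', rfl⟩
      rw [mul_comm]
      refine mul_le_of_isLUB (φ.isLUB' α) ?_
      rintro _ ⟨α', hα', rfl⟩
      rw [mul_comm]
      refine le_trans ?_ (hb ⟨α' + β', lt_of_lt_of_le (ENNReal.add_lt_add hα' hβ') h, rfl⟩)
      exact le_iSup_of_le α' (le_iSup_of_le β' (le_iSup_of_le le_rfl le_rfl))

theorem conv_le {φ ψ χ : DistDistr}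
    (h : ∀ α β, φ α * ψ β ≤ χ (α + β)) : conv φ ψ ≤ χ := fun _ =>
  iSup_le fun α => iSup_le fun β => iSup_le fun hαβ => (h α β).trans (χ.mono hαβ)

theorem le_conv (φ ψ : DistDistr) {α β γ : ℝ≥0∞} (h : α + β ≤ γ) :
    φ α * ψ β ≤ conv φ ψ γ :=
  le_iSup_of_le α (le_iSup_of_le β (le_iSup_of_le h le_rfl))

open Classical in
/-- The map `σ : [0,∞] → Δ`, `σ(α)(γ) = 0` if `γ ≤ α`, and `1` otherwise. -/
noncomputable def sigma (α : ℝ≥0∞) : DistDistr where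
  toFun γ := if γ ≤ α then 0 else 1
  isLUB' β := by
    constructor
    · rintro _ ⟨γ, hγ, rfl⟩
      dsimp only
      split_ifs with h₁ h₂ h₂
      · exact le_rfl
      · exact (1 : I).2.1
      · exact absurd ((le_of_lt hγ).trans h₂) h₁
      · exact le_rfl
    · intro b hb
      split_ifs with h
      · exact b.2.1
      · obtain ⟨γ, hγ₁, hγ₂⟩ := exists_between (not_le.1 h)
        have := hb ⟨γ, hγ₂, rfl⟩
        simpa [not_le.2 hγ₁] using this

open Classical in
/-- The neutral element `κ` of the convolution: `κ(0) = 0` and `κ(α) = 1` for `α > 0`. -/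
noncomputable def kappa : DistDistr where
  toFun γ := if γ = 0 then 0 else 1
  isLUB' β := by
    have h := (sigma 0).isLUB' β
    simpa [sigma] using h

/-- The map `ρ : Δ → [0,∞]`, `ρ(φ) = inf {α | φ(α) = 1}`. -/
noncomputable def rho (φ : DistDistr) : ℝ≥0∞ := sInf {α | φ α = 1}

/-- The map `λ : Δ → [0,∞]`, `λ(φ) = sup {α | φ(α) = 0}`. -/
noncomputable def lam (φ : DistDistr) : ℝ≥0∞ := sSup {α | φ α = 0}

theorem sigma_of_le {α γ : ℝ≥0∞} (h : γ ≤ α) : sigma α γ = 0 := if_pos h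

theorem sigma_of_lt {α γ : ℝ≥0∞} (h : α < γ) : sigma α γ = 1 := if_neg (not_le.2 h)

theorem sigma_zero : sigma 0 = kappa :=
  DistDistr.ext (funext fun γ => by simp [sigma, kappa])

theorem sigma_top : sigma ∞ = ⊥ :=
  DistDistr.ext (funext fun _ => sigma_of_le le_top)

theorem le_sigma_iff {φ : DistDistr} {α : ℝ≥0∞} : φ ≤ sigma α ↔ φ α = 0 := by
  constructor
  · intro h
    exact le_antisymm ((h α).trans (sigma_of_le le_rfl).le) (φ α).2.1
  · intro h γ
    rcases le_or_gt γ α with hγ | hγ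
    · rw [sigma_of_le hγ, ← h]; exact φ.mono hγ
    · rw [sigma_of_lt hγ]; exact (φ γ).2.2

theorem rho_le_iff {φ : DistDistr} {α : ℝ≥0∞} : rho φ ≤ α ↔ sigma α ≤ φ := by
  constructor
  · intro h γ
    rcases le_or_gt γ α with hγ | hγ
    · rw [sigma_of_le hγ]; exact (φ γ).2.1
    · obtain ⟨s, hs, hsγ⟩ := sInf_lt_iff.1 (lt_of_le_of_lt h hγ)
      rw [sigma_of_lt hγ, ← show φ s = 1 from hs]
      exact φ.mono hsγ.le
  · intro h
    refine le_of_forall_gt fun γ hγ => ?_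
    obtain ⟨γ', h₁, h₂⟩ := exists_between hγ
    refine lt_of_le_of_lt (sInf_le ?_) h₂
    have := h γ'
    rw [sigma_of_lt h₁] at this
    exact le_antisymm (φ γ').2.2 this

theorem sigma_le_sigma_iff {α β : ℝ≥0∞} : sigma α ≤ sigma β ↔ β ≤ α := by
  rw [le_sigma_iff]
  constructor
  · intro h
    by_contra hlt
    rw [sigma_of_lt (not_le.1 hlt)] at h
    exact one_ne_zero h
  · exact sigma_of_le

theorem sigma_min (α β : ℝ≥0∞) : sigma (min α β) = sigma α ⊔ sigma β := by
  rcases le_total α β with h | h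
  · rw [min_eq_left h, sup_eq_left.2 (sigma_le_sigma_iff.2 h)]
  · rw [min_eq_right h, sup_eq_right.2 (sigma_le_sigma_iff.2 h)]

theorem sigma_rho_le (φ : DistDistr) : sigma (rho φ) ≤ φ := rho_le_iff.1 le_rfl

theorem rho_anti {φ ψ : DistDistr} (h : φ ≤ ψ) : rho ψ ≤ rho φ :=
  rho_le_iff.2 ((sigma_rho_le φ).trans h)

theorem rho_sigma (α : ℝ≥0∞) : rho (sigma α) = α :=
  le_antisymm (rho_le_iff.2 le_rfl) (sigma_le_sigma_iff.1 (sigma_rho_le _))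

theorem rho_bot : rho ⊥ = ∞ := by rw [← sigma_top, rho_sigma]

theorem rho_sup (φ ψ : DistDistr) : rho (φ ⊔ ψ) = min (rho φ) (rho ψ) := by
  apply le_antisymm
  · exact le_min (rho_anti le_sup_left) (rho_anti le_sup_right)
  · refine le_sInf fun α hα => ?_
    have hα : φ α ⊔ ψ α = 1 := hα
    rcases le_total (φ α) (ψ α) with h | h
    · rw [sup_eq_right.2 h] at hα
      exact (min_le_right _ _).trans (sInf_le hα)
    · rw [sup_eq_left.2 h] at hα
      exact (min_le_left _ _).trans (sInf_le hα)

theorem sigma_add_le_conv (α β : ℝ≥0∞) : sigma (α + β) ≤ conv (sigma α) (sigma β) := by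
  intro γ
  rcases le_or_gt γ (α + β) with hγ | hγ
  · rw [sigma_of_le hγ]; exact (conv _ _ γ).2.1
  · obtain ⟨r, hr, hrγ⟩ := ENNReal.lt_iff_exists_add_pos_lt.1 hγ
    have hfin : α + β ≠ ∞ := (lt_of_lt_of_le hγ le_top).ne
    have hr2 : (r / 2 : ℝ≥0∞) ≠ 0 := by simpa using hr.ne'
    have hα : α < α + r / 2 := ENNReal.lt_add_right (fun h => hfin (by simp [h])) hr2
    have hβ : β < β + r / 2 := ENNReal.lt_add_right (fun h => hfin (by simp [h])) hr2
    have hle : (α + r / 2) + (β + r / 2) ≤ γ := by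
      rw [add_add_add_comm, ENNReal.add_halves]; exact hrγ.le
    have := le_conv (sigma α) (sigma β) hle
    rw [sigma_of_lt hα, sigma_of_lt hβ, one_mul] at this
    rw [sigma_of_lt hγ]; exact this

theorem conv_mono_left {φ φ' ψ : DistDistr} (h : φ ≤ φ') : conv φ ψ ≤ conv φ' ψ := by
  refine conv_le fun α β => le_trans ?_ (le_conv φ' ψ le_rfl)
  exact mul_le_mul_left (h α) (ψ β)

end DistDistr

open DistDistr

/-! ### Approach spaces -/

/-- An approach structure on `X`, given by a point-set distance `δ : X × PX → [0,∞]`. -/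
@[ext]
structure ApproachStructure (X : Type u) where
  dist : X → Set X → ℝ≥0∞
  dist_singleton : ∀ x, dist x {x} = 0
  dist_empty : ∀ x, dist x ∅ = ∞
  dist_union : ∀ x A B, dist x (A ∪ B) = min (dist x A) (dist x B)
  dist_le : ∀ x A (ε : ℝ≥0∞), dist x A ≤ dist x {y | dist y A ≤ ε} + ε

/-- An approach space: a set with an approach structure. -/
structure App : Type (u + 1) where
  carrier : Type u
  str : ApproachStructure carrier

/-- A contractive map of approach spaces. -/
@[ext]
structure App.Hom (X Y : App.{u}) where
  toFun : X.carrier → Y.carrier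
  contractive : ∀ x A, Y.str.dist (toFun x) (toFun '' A) ≤ X.str.dist x A

/-- The category of approach spaces and contractive maps. -/
instance : Category App.{u} where
  Hom := App.Hom
  id X := ⟨id, fun x A => by simp⟩
  comp f g := ⟨g.toFun ∘ f.toFun, fun x A => by
    rw [Set.image_comp]
    exact (g.contractive _ _).trans (f.contractive _ _)⟩

/-- The underlying-set functor of `App`. -/
def App.forgetful : App.{u} ⥤ Type u where
  obj X := X.carrier
  map f := TypeCat.ofHom (App.Hom.toFun f)

/-! ### Probabilistic approach spaces -/

/-- A probabilistic approach structure on `X`, given by a function `δ : X × PX → Δ`. -/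
@[ext]
structure ProbApproachStructure (X : Type u) where
  dist : X → Set X → DistDistr
  dist_singleton : ∀ x, dist x {x} = kappa
  dist_empty : ∀ x, dist x ∅ = ⊥
  dist_union : ∀ x A B, dist x (A ∪ B) = dist x A ⊔ dist x B
  conv_le_dist : ∀ x A (φ : DistDistr), conv (dist x {y | φ ≤ dist y A}) φ ≤ dist x A

/-- A probabilistic approach space: a set with a probabilistic approach structure. -/
structure ProbApp : Type (u + 1) where
  carrier : Type u
  str : ProbApproachStructure carrier

/-- A contractive map of probabilistic approach spaces. -/
@[ext]
structure ProbApp.Hom (X Y : ProbApp.{u}) where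
  toFun : X.carrier → Y.carrier
  contractive : ∀ x A, X.str.dist x A ≤ Y.str.dist (toFun x) (toFun '' A)

/-- The category of probabilistic approach spaces and contractive maps. -/
instance : Category ProbApp.{u} where
  Hom := ProbApp.Hom
  id X := ⟨id, fun x A => by simp⟩
  comp f g := ⟨g.toFun ∘ f.toFun, fun x A => by
    rw [Set.image_comp]
    exact (f.contractive _ _).trans (g.contractive _ _)⟩

/-- The underlying-set functor of `ProbApp`. -/
def ProbApp.forgetful : ProbApp.{u} ⥤ Type u where
  obj X := X.carrier
  map f := TypeCat.ofHom (ProbApp.Hom.toFun f)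

/-! ### Change of base along `σ` and along `ρ` -/

/-- The probabilistic approach structure `σ ∘ δ` induced by an approach structure `δ`. -/
noncomputable def ApproachStructure.baseChangeSigma {X : Type u} (d : ApproachStructure X) :
    ProbApproachStructure X where
  dist x A := sigma (d.dist x A)
  dist_singleton x := by rw [d.dist_singleton, sigma_zero]
  dist_empty x := by rw [d.dist_empty, sigma_top]
  dist_union x A B := by rw [d.dist_union, sigma_min]
  conv_le_dist x A φ := by
    refine conv_le fun α β => ?_
    by_cases hφ : φ β = 0
    · rw [hφ, mul_zero]; exact (sigma _ _).2.1
    rcases le_or_gt α (d.dist x {y | φ ≤ sigma (d.dist y A)}) with hα | hα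
    · rw [sigma_of_le hα, zero_mul]; exact (sigma _ _).2.1
    have hset : {y | φ ≤ sigma (d.dist y A)} = {y | d.dist y A ≤ lam φ} := by
      ext y
      simp only [Set.mem_ofPred_eq, le_sigma_iff]
      constructor
      · intro h
        exact le_sSup h
      · intro h
        refine le_antisymm (φ.le_of_forall_lt fun γ hγ => ?_) (φ _).2.1
        obtain ⟨s, hs, hγs⟩ := lt_sSup_iff.1 (lt_of_lt_of_le hγ h)
        exact (φ.mono hγs.le).trans (le_of_eq hs)
    have hβ : lam φ ≤ β := by
      refine sSup_le fun s hs => ?_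
      by_contra hlt
      exact hφ (le_antisymm ((φ.mono (not_le.1 hlt).le).trans (le_of_eq hs)) (φ β).2.1)
    rw [hset] at hα
    have hlt : d.dist x A < α + β := by
      rcases eq_or_ne β ∞ with rfl | hβ'
      · obtain ⟨γ, hγ, hγ'⟩ : ∃ γ, γ < ∞ ∧ φ γ ≠ 0 := by
          by_contra hcon
          push Not at hcon
          exact hφ (le_antisymm (φ.le_of_forall_lt fun γ hγ => (hcon γ hγ).le) (φ _).2.1)
        have hlam : lam φ ≤ γ := by
          refine sSup_le fun s hs => ?_
          by_contra hlt
          exact hγ' (le_antisymm ((φ.mono (not_le.1 hlt).le).trans (le_of_eq hs)) (φ γ).2.1)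
        rw [add_top]
        refine lt_of_le_of_lt (d.dist_le x A (lam φ)) (ENNReal.add_lt_top.2 ⟨?_, ?_⟩)
        · exact lt_of_lt_of_le hα le_top
        · exact lt_of_le_of_lt hlam hγ
      · refine lt_of_le_of_lt (d.dist_le x A (lam φ)) ?_
        exact ENNReal.add_lt_add_of_lt_of_le (ne_top_of_le_ne_top hβ' hβ) hα hβ
    rw [sigma_of_lt hlt]
    exact (_ : I).2.2

/-- The approach structure `ρ ∘ δ` induced by a probabilistic approach structure `δ`. -/
noncomputable def ProbApproachStructure.baseChangeRho {X : Type u}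
    (d : ProbApproachStructure X) : ApproachStructure X where
  dist x A := rho (d.dist x A)
  dist_singleton x := by rw [d.dist_singleton, ← sigma_zero, rho_sigma]
  dist_empty x := by rw [d.dist_empty, rho_bot]
  dist_union x A B := by rw [d.dist_union, rho_sup]
  dist_le x A ε := by
    rw [rho_le_iff]
    simp only [rho_le_iff]
    exact (sigma_add_le_conv _ _).trans
      ((conv_mono_left (sigma_rho_le _)).trans (d.conv_le_dist x A (sigma ε)))

/-- The change-of-base functor `B_σ : App ⥤ ProbApp`, `(X, δ) ↦ (X, σ ∘ δ)`, `f ↦ f`. -/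
noncomputable def baseChangeSigma : App.{u} ⥤ ProbApp.{u} where
  obj X := ⟨X.carrier, X.str.baseChangeSigma⟩
  map f := ⟨App.Hom.toFun f, fun x A => sigma_le_sigma_iff.2 (App.Hom.contractive f x A)⟩

/-- The change-of-base functor `B_ρ : ProbApp ⥤ App`, `(X, δ) ↦ (X, ρ ∘ δ)`, `f ↦ f`. -/
noncomputable def baseChangeRho : ProbApp.{u} ⥤ App.{u} where
  obj X := ⟨X.carrier, X.str.baseChangeRho⟩
  map f := ⟨ProbApp.Hom.toFun f, fun x A => rho_anti (ProbApp.Hom.contractive f x A)⟩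

/-- `d` is the approach structure generated by `λ ∘ δ`: with respect to the order `≥` of
the quantale `[0,∞]`, it is the least approach structure above `λ ∘ δ`, i.e. numerically the
largest approach distance with `d(x,A) ≤ λ(δ(x,A))` for all `x`, `A`. -/
def IsGeneratedByLam {X : Type u} (δ : ProbApproachStructure X) (d : ApproachStructure X) :
    Prop :=
  (∀ x A, d.dist x A ≤ lam (δ.dist x A)) ∧
    ∀ d' : ApproachStructure X, (∀ x A, d'.dist x A ≤ lam (δ.dist x A)) →
      ∀ x A, d'.dist x A ≤ d.dist x A

/-! ### The adjunctions between `[0,∞]` and distance distribution functions -/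

namespace DistDistr

/-! Both adjunctions come from left continuity and the two-valued form of `sigma`; `sigma` is
moreover an order embedding, which gives fullness, faithfulness and injectivity. On the right, `rho`
turns the axioms for `δ` into those for `rho ∘ δ`, so the coreflection is pointwise. On the left,
`lam ∘ δ` satisfies the empty-set and union axioms, but the adjunction controls `α ≤ lam φ`, not
`lam φ ≤ α`, so the triangle axiom is not inherited. One passes to the largest approach structure
below `lam ∘ δ`, built in `generate` as a supremum of lower regular functions. Its maximality,
tested on structures pulled back along maps (`comap`), gives functoriality and the universal
property. -/

theorem le_sigma_iff_le_lam {φ : DistDistr} {α : ℝ≥0∞} : φ ≤ sigma α ↔ α ≤ lam φ := by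
  rw [le_sigma_iff]
  refine ⟨fun h => le_sSup h, fun h => ?_⟩
  -- By left continuity it suffices that `φ` vanishes strictly below `α`, where a zero of `φ`
  -- further up forces it.
  refine le_antisymm (φ.le_of_forall_lt fun γ hγ => ?_) (φ _).2.1
  obtain ⟨s, hs, hγs⟩ := lt_sSup_iff.1 (lt_of_lt_of_le hγ h)
  exact (φ.mono hγs.le).trans (le_of_eq hs)

theorem sigma_injective : Function.Injective sigma := fun α β h => by
  rw [← rho_sigma α, h, rho_sigma]

theorem lam_sigma (α : ℝ≥0∞) : lam (sigma α) = α :=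
  le_antisymm (sigma_le_sigma_iff.1 (le_sigma_iff_le_lam.2 le_rfl))
    (le_sigma_iff_le_lam.1 le_rfl)

/-- A left adjoint preserves joins, and joins in the reversed order are minima. -/
theorem lam_sup (φ ψ : DistDistr) : lam (φ ⊔ ψ) = min (lam φ) (lam ψ) :=
  eq_of_forall_le_iff fun α => by
    rw [← le_sigma_iff_le_lam, sup_le_iff, le_min_iff, le_sigma_iff_le_lam, le_sigma_iff_le_lam]

theorem gc_lam_sigma : GaloisConnection (fun φ : DistDistr => OrderDual.toDual (lam φ))
    (fun α : ℝ≥0∞ᵒᵈ => sigma (OrderDual.ofDual α)) :=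
  fun _ _ => le_sigma_iff_le_lam.symm

theorem gc_sigma_rho : GaloisConnection (fun α : ℝ≥0∞ᵒᵈ => sigma (OrderDual.ofDual α))
    (fun φ : DistDistr => OrderDual.toDual (rho φ)) :=
  fun _ _ => rho_le_iff.symm

end DistDistr

/-! ### Elementary properties and pullback of approach structures -/

namespace ApproachStructure

variable {X Y : Type u}

theorem dist_anti (d : ApproachStructure X) (x : X) {A B : Set X} (h : A ⊆ B) :
    d.dist x B ≤ d.dist x A := by
  rw [← Set.union_eq_self_of_subset_left h, d.dist_union]
  exact min_le_left _ _

theorem dist_eq_zero_of_mem (d : ApproachStructure X) {x : X} {A : Set X} (h : x ∈ A) :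
    d.dist x A = 0 :=
  le_antisymm ((d.dist_anti x (Set.singleton_subset_iff.2 h)).trans (d.dist_singleton x).le)
    bot_le

/-- With `ε` the supremum of `d(·,A)` over `B`, the set `B` lies in `A^(ε)`. Thus each `d(·,A)` is
lower regular for `d`. -/
theorem dist_le_iSup_add (d : ApproachStructure X) (x : X) (A B : Set X) :
    d.dist x A ≤ (⨆ y ∈ B, d.dist y A) + d.dist x B := by
  rw [add_comm]
  refine (d.dist_le x A (⨆ y ∈ B, d.dist y A)).trans ?_
  gcongr
  exact d.dist_anti x fun y hy => le_iSup₂ (f := fun y (_ : y ∈ B) => d.dist y A) y hy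

theorem baseChangeSigma_injective :
    Function.Injective (baseChangeSigma : ApproachStructure X → ProbApproachStructure X) :=
  fun _ _ h => ApproachStructure.ext (funext fun x => funext fun A =>
    sigma_injective (congrFun (congrFun (congrArg ProbApproachStructure.dist h) x) A))

/-- The initial approach structure along a map. -/
def comap (f : X → Y) (d : ApproachStructure Y) : ApproachStructure X where
  dist x A := d.dist (f x) (f '' A)
  dist_singleton x := by rw [Set.image_singleton, d.dist_singleton]
  dist_empty x := by rw [Set.image_empty, d.dist_empty]
  dist_union x A B := by rw [Set.image_union, d.dist_union]
  dist_le x A ε := by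
    refine (d.dist_le (f x) (f '' A) ε).trans ?_
    gcongr
    refine d.dist_anti _ ?_
    rintro _ ⟨y, hy, rfl⟩
    exact hy

end ApproachStructure

/-- The lower regular functions of a point-set function `c`. -/
def IsLowerRegular {X : Type u} (c : X → Set X → ℝ≥0∞) (f : X → ℝ≥0∞) : Prop :=
  ∀ x A, f x ≤ (⨆ y ∈ A, f y) + c x A

/-! ### Closure properties of lower regular functions -/

namespace IsLowerRegular

variable {X : Type u} {c : X → Set X → ℝ≥0∞} {f g : X → ℝ≥0∞}

theorem le_add (hf : IsLowerRegular c f) {x : X} {A : Set X} {s : ℝ≥0∞}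
    (hs : ∀ y ∈ A, f y ≤ s) : f x ≤ s + c x A :=
  (hf x A).trans (by gcongr; exact iSup₂_le hs)

theorem top (hc : ∀ x, c x ∅ = ∞) : IsLowerRegular c fun _ => ∞ := fun x A => by
  rcases A.eq_empty_or_nonempty with rfl | hA
  · simp [hc]
  · rw [biSup_const hA, top_add]

/-- Since the order is total, `A` splits into a part where `f ≤ s` and a part where `g ≤ s`; finite
additivity of `c` recombines the two estimates. -/
theorem min (hc : ∀ x A B, c x (A ∪ B) = min (c x A) (c x B))
    (hf : IsLowerRegular c f) (hg : IsLowerRegular c g) :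
    IsLowerRegular c fun x => min (f x) (g x) := fun x A => by
  set s := ⨆ y ∈ A, Min.min (f y) (g y)
  have hA : A = {y ∈ A | f y ≤ s} ∪ {y ∈ A | g y ≤ s} := by
    rw [← Set.sep_or, eq_comm, Set.sep_eq_self_iff_mem_true]
    exact fun y hy => min_le_iff.1 (le_iSup₂ (f := fun y (_ : y ∈ A) => Min.min (f y) (g y)) y hy)
  have hf' := hf.le_add (x := x) (A := {y ∈ A | f y ≤ s}) fun y hy => hy.2
  have hg' := hg.le_add (x := x) (A := {y ∈ A | g y ≤ s}) fun y hy => hy.2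
  rw [hA, hc, ← min_add_add_left]
  exact min_le_min hf' hg'

theorem tsub_const (hf : IsLowerRegular c f) (ε : ℝ≥0∞) :
    IsLowerRegular c fun x => f x - ε := fun x A => by
  rw [tsub_le_iff_right, add_right_comm]
  refine hf.le_add fun y hy => ?_
  rw [← tsub_le_iff_right]
  exact le_iSup₂ (f := fun y (_ : y ∈ A) => f y - ε) y hy

end IsLowerRegular

/-! ### The generated approach structure -/

namespace ApproachStructure

variable {X : Type u}

/-- The numerically largest approach structure below a finitely additive point-set function `c`:
`d(x,A)` is the supremum of `f x` over the lower regular functions `f` of `c` vanishing on `A`. -/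
noncomputable def generate (c : X → Set X → ℝ≥0∞)
    (he : ∀ x, c x ∅ = ∞) (hu : ∀ x A B, c x (A ∪ B) = min (c x A) (c x B)) :
    ApproachStructure X where
  dist x A := ⨆ (f : X → ℝ≥0∞) (_ : IsLowerRegular c f) (_ : ∀ a ∈ A, f a = 0), f x
  dist_singleton x := le_antisymm
    (iSup_le fun f => iSup₂_le fun _ h => (h x rfl).le) bot_le
  dist_empty x := top_le_iff.1 <|
    le_iSup_of_le (fun _ => ∞) (le_iSup₂_of_le (.top he) (by simp) le_rfl)
  dist_union x A B := by
    apply le_antisymm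
    · refine iSup_le fun f => iSup₂_le fun hf h => le_min ?_ ?_
      · exact le_iSup_of_le f (le_iSup₂_of_le hf (fun a ha => h a (.inl ha)) le_rfl)
      · exact le_iSup_of_le f (le_iSup₂_of_le hf (fun a ha => h a (.inr ha)) le_rfl)
    -- Strict lower bounds are realised by single functions `f` and `g`, whose minimum vanishes on
    -- `A ∪ B`.
    · refine le_of_forall_lt fun b hb => ?_
      obtain ⟨hA, hB⟩ := lt_min_iff.1 hb
      simp only [lt_iSup_iff] at hA hB ⊢
      obtain ⟨f, hf, hfA, hfx⟩ := hA
      obtain ⟨g, hg, hgB, hgx⟩ := hB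
      refine ⟨_, hf.min hu hg, ?_, lt_min hfx hgx⟩
      rintro a (ha | ha)
      · simp [hfA a ha]
      · simp [hgB a ha]
  dist_le x A ε := by
    refine iSup_le fun f => iSup₂_le fun hf h => ?_
    rw [← tsub_le_iff_right]
    -- The witness is `f - ε`: on `A^(ε)` one has `f y ≤ d(y,A) ≤ ε`, so it vanishes there.
    refine le_iSup_of_le _ (le_iSup₂_of_le (hf.tsub_const ε) (fun y hy => ?_) le_rfl)
    refine tsub_eq_zero_of_le (le_trans ?_ hy)
    exact le_iSup_of_le f (le_iSup₂_of_le hf h le_rfl)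

section

variable {c : X → Set X → ℝ≥0∞}
    (he : ∀ x, c x ∅ = ∞) (hu : ∀ x A B, c x (A ∪ B) = min (c x A) (c x B))

theorem generate_dist_le (x : X) (A : Set X) : (generate c he hu).dist x A ≤ c x A :=
  iSup_le fun _ => iSup₂_le fun hf h => (hf.le_add fun y hy => (h y hy).le).trans (zero_add _).le

/-- The function `d(·,A)` vanishes on `A` and is lower regular for `d`, hence for the larger `c`, so
it takes part in the supremum. -/
theorem le_generate_dist {d : ApproachStructure X} (h : ∀ x A, d.dist x A ≤ c x A)
    (x : X) (A : Set X) : d.dist x A ≤ (generate c he hu).dist x A := by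
  refine le_iSup_of_le (fun y => d.dist y A) (le_iSup₂_of_le (fun y B => ?_)
    (fun a ha => d.dist_eq_zero_of_mem ha) le_rfl)
  exact (d.dist_le_iSup_add y A B).trans (by gcongr; exact h y B)

end

end ApproachStructure

/-! ### Reflection, coreflection and the embedding -/

namespace ProbApproachStructure

variable {X : Type u}

/-- The approach structure generated by `λ ∘ δ`. -/
noncomputable def generateLam (δ : ProbApproachStructure X) : ApproachStructure X :=
  .generate (fun x A => lam (δ.dist x A))
    (fun x => by rw [δ.dist_empty, ← sigma_top, lam_sigma])
    (fun x A B => by rw [δ.dist_union, lam_sup])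

theorem isGeneratedByLam_generateLam (δ : ProbApproachStructure X) :
    IsGeneratedByLam δ δ.generateLam :=
  ⟨ApproachStructure.generate_dist_le _ _, fun _ h => ApproachStructure.le_generate_dist _ _ h⟩

end ProbApproachStructure

/-- The reflector `ProbApp ⥤ App`, `(X, δ) ↦ (X, d)` with `d` generated by `λ ∘ δ`. -/
noncomputable def generateLamFunctor : ProbApp.{u} ⥤ App.{u} where
  obj P := ⟨P.carrier, P.str.generateLam⟩
  map {P Q} f := ⟨ProbApp.Hom.toFun f,
    -- The structure pulled back from `Q` lies below `lam ∘ δ` on `P`, hence below the generated one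
    -- by maximality; this is contractivity.
    P.str.isGeneratedByLam_generateLam.2 (Q.str.generateLam.comap (ProbApp.Hom.toFun f))
      fun x A => (Q.str.isGeneratedByLam_generateLam.1 _ _).trans
        (gc_lam_sigma.monotone_l (ProbApp.Hom.contractive f x A))⟩

/-- The adjunction between the reflector and `B_σ`. -/
noncomputable def generateLamAdjunction : generateLamFunctor.{u} ⊣ baseChangeSigma.{u} :=
  Adjunction.mkOfHomEquiv
    { homEquiv := fun P Y =>
        { toFun := fun f => ⟨App.Hom.toFun f, fun x A => le_sigma_iff_le_lam.2
            ((App.Hom.contractive f x A).trans (P.str.isGeneratedByLam_generateLam.1 x A))⟩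
          -- Transposing across `lam ⊣ sigma` only bounds the pullback of `Y` by `lam ∘ δ`;
          -- maximality upgrades the bound to the generated structure.
          invFun := fun f => ⟨ProbApp.Hom.toFun f,
            P.str.isGeneratedByLam_generateLam.2 (Y.str.comap (ProbApp.Hom.toFun f))
              fun x A => le_sigma_iff_le_lam.1 (ProbApp.Hom.contractive f x A)⟩
          left_inv := fun _ => rfl
          right_inv := fun _ => rfl }
      homEquiv_naturality_left_symm := fun _ _ => rfl
      homEquiv_naturality_right := fun _ _ => rfl }

/-- The adjunction between `B_σ` and `B_ρ`. -/
noncomputable def baseChangeAdjunction : baseChangeSigma.{u} ⊣ baseChangeRho.{u} :=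
  Adjunction.mkOfHomEquiv
    { homEquiv := fun _ _ =>
        { toFun := fun f => ⟨ProbApp.Hom.toFun f, fun x A =>
            rho_le_iff.2 (ProbApp.Hom.contractive f x A)⟩
          invFun := fun f => ⟨App.Hom.toFun f, fun x A =>
            rho_le_iff.1 (App.Hom.contractive f x A)⟩
          left_inv := fun _ => rfl
          right_inv := fun _ => rfl }
      homEquiv_naturality_left_symm := fun _ _ => rfl
      homEquiv_naturality_right := fun _ _ => rfl }

theorem baseChangeSigma_obj_injective : Function.Injective baseChangeSigma.{u}.obj := by
  rintro ⟨X, d⟩ ⟨Y, d'⟩ h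
  obtain ⟨rfl, h⟩ := (ProbApp.mk.injEq _ _ _ _).mp h
  exact congrArg (App.mk X) (ApproachStructure.baseChangeSigma_injective (eq_of_heq h))

instance : baseChangeSigma.{u}.Full where
  map_surjective f := ⟨⟨ProbApp.Hom.toFun f, fun x A =>
    sigma_le_sigma_iff.1 (ProbApp.Hom.contractive f x A)⟩, rfl⟩

instance : baseChangeSigma.{u}.Faithful where
  map_injective h := App.Hom.ext (congrArg ProbApp.Hom.toFun h)

/-- In the quantale `[0,∞]` the order is the opposite of the numerical one, whence `ℝ≥0∞ᵒᵈ`. -/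
theorem corollary4p7 :
    -- the adjunctions `λ ⊣ σ ⊣ ρ` of monotone maps
    GaloisConnection (fun φ : DistDistr => OrderDual.toDual (DistDistr.lam φ))
      (fun α : ℝ≥0∞ᵒᵈ => DistDistr.sigma (OrderDual.ofDual α)) ∧
    GaloisConnection (fun α : ℝ≥0∞ᵒᵈ => DistDistr.sigma (OrderDual.ofDual α))
      (fun φ : DistDistr => OrderDual.toDual (DistDistr.rho φ)) ∧
    -- `B_σ` is a full embedding
    Function.Injective (baseChangeSigma.{u}.obj) ∧
    baseChangeSigma.{u}.Full ∧ baseChangeSigma.{u}.Faithful ∧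
    -- it is reflective, the reflector being `(X, δ) ↦ (X, d)` with `d` generated by `λ ∘ δ`
    (∃ _ : Reflective baseChangeSigma.{u},
      reflector baseChangeSigma.{u} ⋙ App.forgetful = ProbApp.forgetful ∧
      ∀ P : ProbApp.{u}, ∃ d : ApproachStructure P.carrier,
        IsGeneratedByLam P.str d ∧ (reflector baseChangeSigma.{u}).obj P = ⟨P.carrier, d⟩) ∧
    -- it is coreflective, the coreflector being `B_ρ : (X, δ) ↦ (X, ρ ∘ δ)`
    (∃ _ : Coreflective baseChangeSigma.{u},
      coreflector baseChangeSigma.{u} = baseChangeRho.{u}) := by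
  exact ⟨gc_lam_sigma, gc_sigma_rho, baseChangeSigma_obj_injective, inferInstance, inferInstance,
    ⟨{ L := generateLamFunctor, adj := generateLamAdjunction }, rfl,
      fun P => ⟨_, P.str.isGeneratedByLam_generateLam, rfl⟩⟩,
    ⟨{ R := baseChangeRho, adj := baseChangeAdjunction }, rfl⟩⟩
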